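/- Let $(M,g)$ be a compact connected smooth Riemannian manifold without boundary, let $q$ be a smooth $(0,2)$-tensor field on $M$, let $f:M\to\mathbb{R}$ be a smooth function, and let $\lambda\in\mathbb{R}$. Suppose that $(M,g,f)$ is a gradient $q$-soliton, that is, $$\operatorname{Hess} f=\lambda g+\tfrac12 q .$$ Let $Q$ be the $(1,1)$-tensor dual to $q$, so that $g(Q(X),Y)=q(X,Y)$ for all tangent vectors $X,Y$, and let $\operatorname{tr}(q)$ be the trace of $Q$. If $\lambda\le 0$ and $$Q(\nabla f)=\tfrac12\nabla\operatorname{tr}(q)\quad\text{on } M,$$ then $f$ is constant. -/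

import Mathlib

open Bundle Manifold
open scoped ContDiff

noncomputable section

namespace RiemannianGeometry

variable {E : Type*} [NormedAddCommGroup E] [NormedSpace ℝ E]
  {H : Type*} [TopologicalSpace H] {I : ModelWithCorners ℝ E H}
  {M : Type*} [TopologicalSpace M] [ChartedSpace H M] [IsManifold I ∞ M]

variable (g : ContMDiffRiemannianMetric I ∞ E (fun x : M ↦ TangentSpace I x))

/-- The metric at `x`, as a bilinear form on the tangent space. -/
def form (x : M) : LinearMap.BilinForm ℝ (TangentSpace I x) := (g.inner x).toBilinForm

lemma form_apply (x : M) (u v : TangentSpace I x) : form g x u v = g.inner x u v := rfl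

lemma metric_ext (x : M) {u v : TangentSpace I x}
    (h : ∀ w, g.inner x u w = g.inner x v w) : u = v := by
  by_contra hne
  have hp := g.pos x (u - v) (sub_ne_zero.2 hne)
  have h0 : g.inner x (u - v) (u - v) = 0 := by
    rw [(g.inner x).map_sub u v, sub_apply, h, sub_self]
  exact absurd h0 hp.ne'

lemma form_nondegenerate (x : M) : (form g x).Nondegenerate := by
  constructor
  · intro u hu
    exact metric_ext g x fun w ↦ by simpa [form_apply] using hu w
  · intro u hu
    refine metric_ext g x fun w ↦ ?_
    rw [g.symm]
    simpa [form_apply] using hu w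

lemma mdifferentiableAt_metric {Y Z : Π x : M, TangentSpace I x} {x : M}
    (hY : MDiffAt (T% Y) x) (hZ : MDiffAt (T% Z) x) :
    MDiffAt (fun y ↦ g.inner y (Y y) (Z y)) x := by
  have : MDifferentiableAt I (I.prod 𝓘(ℝ))
      (fun m ↦ TotalSpace.mk' ℝ (E := Bundle.Trivial M ℝ) m (g.inner m (Y m) (Z m))) x := by
    apply MDifferentiableAt.clm_bundle_apply₂ (F₁ := E) (F₂ := E)
    · exact g.contMDiff.mdifferentiableAt (by simp)
    · exact hY
    · exact hZ
  simp only [mdifferentiableAt_totalSpace] at this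
  exact this.2

/-- Two endomorphisms agree if they agree against all differentiable fields. -/
lemma ext_fields {x : M} {A B : TangentSpace I x →L[ℝ] TangentSpace I x}
    (h : ∀ X Z : Π x : M, TangentSpace I x, MDiffAt (T% X) x → MDiffAt (T% Z) x →
      g.inner x (A (X x)) (Z x) = g.inner x (B (X x)) (Z x)) : A = B := by
  ext u
  refine metric_ext g x fun w ↦ ?_
  simpa using h (FiberBundle.extend E u) (FiberBundle.extend E w)
    (FiberBundle.mdifferentiableAt_extend ..) (FiberBundle.mdifferentiableAt_extend ..)

variable [FiniteDimensional ℝ E]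

instance instFiniteDimensionalTangent (x : M) : FiniteDimensional ℝ (TangentSpace I x) :=
  inferInstanceAs (FiniteDimensional ℝ E)

instance instT2SpaceTangent (x : M) : T2Space (TangentSpace I x) :=
  inferInstanceAs (T2Space E)

/-- The sharp (musical) isomorphism of `g` at `x`: the covector `φ` goes to the vector `u` with
`g(u, v) = φ v` for all `v`. -/
def sharp (x : M) : Module.Dual ℝ (TangentSpace I x) ≃ₗ[ℝ] TangentSpace I x :=
  ((form g x).toDual (form_nondegenerate g x)).symm

lemma inner_sharp (x : M) (φ : Module.Dual ℝ (TangentSpace I x)) (v : TangentSpace I x) :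
    g.inner x (sharp g x φ) v = φ v :=
  LinearMap.BilinForm.apply_toDual_symm_apply (hB := form_nondegenerate g x) φ v

/-- The endomorphism `B` of the tangent space at `x` that is dual to the bilinear form `b`:
`g(B u, v) = b(u, v)`. -/
def raise (x : M) (b : TangentSpace I x →L[ℝ] TangentSpace I x →L[ℝ] ℝ) :
    TangentSpace I x →L[ℝ] TangentSpace I x :=
  LinearMap.toContinuousLinearMap ((sharp g x).toLinearMap ∘ₗ b.toBilinForm)

lemma inner_raise (x : M) (b : TangentSpace I x →L[ℝ] TangentSpace I x →L[ℝ] ℝ)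
    (u v : TangentSpace I x) : g.inner x (raise g x b u) v = b u v :=
  inner_sharp g x _ v

/-- The right-hand side of the Koszul formula for `2 g(∇_X Y, Z)` at `x`. -/
def koszul (X Y Z : Π x : M, TangentSpace I x) (x : M) : ℝ :=
  mvfderiv I (fun y ↦ g.inner y (Y y) (Z y)) x (X x)
    + mvfderiv I (fun y ↦ g.inner y (Z y) (X y)) x (Y x)
    - mvfderiv I (fun y ↦ g.inner y (X y) (Y y)) x (Z x)
    + g.inner x (VectorField.mlieBracket I X Y x) (Z x)
    - g.inner x (VectorField.mlieBracket I X Z x) (Y x)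
    - g.inner x (VectorField.mlieBracket I Y Z x) (X x)

lemma koszul_tensorial_left {Y Z : Π x : M, TangentSpace I x} {x : M}
    (hY : MDiffAt (T% Y) x) (hZ : MDiffAt (T% Z) x) :
    TensorialAt I E (fun X ↦ koszul g X Y Z x) x where
  smul {f X} hf hX := by
    have h1 := mvfderiv_fun_mul hf (mdifferentiableAt_metric g hZ hX)
    have h2 := mvfderiv_fun_mul hf (mdifferentiableAt_metric g hX hY)
    simp [koszul, VectorField.mlieBracket_smul_left hf hX, h1, h2, g.symm x (Z x) (X x)]
    ring
  add {X X'} hX hX' := by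
    have h1 := mvfderiv_fun_add (mdifferentiableAt_metric g hZ hX)
      (mdifferentiableAt_metric g hZ hX')
    have h2 := mvfderiv_fun_add (mdifferentiableAt_metric g hX hY)
      (mdifferentiableAt_metric g hX' hY)
    simp [koszul, VectorField.mlieBracket_add_left hX hX', h1, h2]
    ring

lemma koszul_tensorial_right {X Y : Π x : M, TangentSpace I x} {x : M}
    (hX : MDiffAt (T% X) x) (hY : MDiffAt (T% Y) x) :
    TensorialAt I E (fun Z ↦ koszul g X Y Z x) x where
  smul {f Z} hf hZ := by
    have h1 := mvfderiv_fun_mul hf (mdifferentiableAt_metric g hZ hX)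
    have h2 := mvfderiv_fun_mul hf (mdifferentiableAt_metric g hY hZ)
    simp [koszul, VectorField.mlieBracket_smul_right hf hZ, h1, h2, g.symm x (Z x) (X x),
      g.symm x (Z x) (Y x)]
    ring
  add {Z Z'} hZ hZ' := by
    have h1 := mvfderiv_fun_add (mdifferentiableAt_metric g hZ hX)
      (mdifferentiableAt_metric g hZ' hX)
    have h2 := mvfderiv_fun_add (mdifferentiableAt_metric g hY hZ)
      (mdifferentiableAt_metric g hY hZ')
    simp [koszul, VectorField.mlieBracket_add_right hZ hZ', h1, h2]
    ring

/-- The bilinear form `(X, Z) ↦ 2 g(∇_X Y, Z)` at `x`, for a field `Y` differentiable at `x`. -/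
def koszulForm {Y : Π x : M, TangentSpace I x} {x : M} (hY : MDiffAt (T% Y) x) :
    TangentSpace I x →L[ℝ] TangentSpace I x →L[ℝ] ℝ :=
  TensorialAt.mkHom₂ (I := I) (F := E) (F' := E) (fun X Z ↦ koszul g X Y Z x) x
    (fun _ hZ ↦ koszul_tensorial_left g hY hZ) (fun _ hX ↦ koszul_tensorial_right g hX hY)

lemma koszulForm_apply {X Y Z : Π x : M, TangentSpace I x} {x : M}
    (hX : MDiffAt (T% X) x) (hY : MDiffAt (T% Y) x) (hZ : MDiffAt (T% Z) x) :
    koszulForm g hY (X x) (Z x) = koszul g X Y Z x :=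
  TensorialAt.mkHom₂_apply _ _ hX hZ

open Classical in
/-- `∇ Y`, from the Koszul formula; it is set to `0` where `Y` is not differentiable. -/
def nabla (Y : Π x : M, TangentSpace I x) (x : M) : TangentSpace I x →L[ℝ] TangentSpace I x :=
  if hY : MDiffAt (T% Y) x then raise g x ((1 / 2 : ℝ) • koszulForm g hY) else 0

lemma inner_nabla {X Y Z : Π x : M, TangentSpace I x} {x : M}
    (hX : MDiffAt (T% X) x) (hY : MDiffAt (T% Y) x) (hZ : MDiffAt (T% Z) x) :
    g.inner x (nabla g Y x (X x)) (Z x) = 1 / 2 * koszul g X Y Z x := by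
  rw [nabla, dif_pos hY, inner_raise, smul_apply,
    smul_apply, koszulForm_apply g hX hY hZ, smul_eq_mul]

/-- The Levi-Civita connection of the Riemannian metric `g`. -/
def leviCivita : CovariantDerivative I E (TangentSpace I : M → Type _) where
  toFun := nabla g
  isCovariantDerivativeOnUniv :=
    { add := by
        intro Y Y' x hY hY' _
        refine ext_fields g fun X Z hX hZ ↦ ?_
        rw [add_apply, map_add, add_apply,
          inner_nabla g hX (mdifferentiableAt_add_section hY hY') hZ,
          inner_nabla g hX hY hZ, inner_nabla g hX hY' hZ]
        have h1 := mvfderiv_fun_add (mdifferentiableAt_metric g hY hZ)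
          (mdifferentiableAt_metric g hY' hZ)
        have h2 := mvfderiv_fun_add (mdifferentiableAt_metric g hX hY)
          (mdifferentiableAt_metric g hX hY')
        simp [koszul, VectorField.mlieBracket_add_left hY hY',
          VectorField.mlieBracket_add_right hY hY', h1, h2]
        ring
      leibniz := by
        intro Y f x hY hf _
        refine ext_fields g fun X Z hX hZ ↦ ?_
        rw [add_apply, map_add, add_apply,
          inner_nabla g hX (hf.smul_section hY) hZ, smul_apply, map_smul,
          smul_apply, inner_nabla g hX hY hZ]
        have h1 := mvfderiv_fun_mul hf (mdifferentiableAt_metric g hY hZ)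
        have h2 := mvfderiv_fun_mul hf (mdifferentiableAt_metric g hX hY)
        simp [koszul, VectorField.mlieBracket_smul_left hf hY,
          VectorField.mlieBracket_smul_right hf hY, h1, h2, g.symm x (Y x) (X x)]
        ring }

lemma leviCivita_metric {X Y Z : Π x : M, TangentSpace I x} {x : M}
    (hX : MDiffAt (T% X) x) (hY : MDiffAt (T% Y) x) (hZ : MDiffAt (T% Z) x) :
    mvfderiv I (fun y ↦ g.inner y (Y y) (Z y)) x (X x) =
      g.inner x (leviCivita g Y x (X x)) (Z x) + g.inner x (Y x) (leviCivita g Z x (X x)) := by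
  have e (U V : Π x : M, TangentSpace I x) :
      (fun y ↦ g.inner y (U y) (V y)) = fun y ↦ g.inner y (V y) (U y) :=
    funext fun y ↦ g.symm y _ _
  have h1 : g.inner x (leviCivita g Y x (X x)) (Z x) = _ := inner_nabla g hX hY hZ
  have h2 : g.inner x (leviCivita g Z x (X x)) (Y x) = _ := inner_nabla g hX hZ hY
  rw [g.symm x (Y x), h1, h2, koszul, koszul, e Z Y, e X Z, e Y X,
    VectorField.mlieBracket_swap_apply (V := Z) (W := Y)]
  simp
  ring

lemma leviCivita_torsion : (leviCivita g).torsion = 0 := by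
  rw [CovariantDerivative.torsion_eq_zero_iff]
  intro X Y x hX hY
  refine metric_ext g x fun w ↦ ?_
  obtain ⟨Z, hZ, rfl⟩ : ∃ Z : Π x : M, TangentSpace I x, MDiffAt (T% Z) x ∧ Z x = w :=
    ⟨FiberBundle.extend E w, FiberBundle.mdifferentiableAt_extend .., by simp⟩
  have e (U V : Π x : M, TangentSpace I x) :
      (fun y ↦ g.inner y (U y) (V y)) = fun y ↦ g.inner y (V y) (U y) :=
    funext fun y ↦ g.symm y _ _
  have h1 : g.inner x (leviCivita g Y x (X x)) (Z x) = _ := inner_nabla g hX hY hZ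
  have h2 : g.inner x (leviCivita g X x (Y x)) (Z x) = _ := inner_nabla g hY hX hZ
  rw [map_sub, sub_apply, h1, h2, koszul, koszul, e Z X, e Y X, e Z Y,
    VectorField.mlieBracket_swap_apply (V := Y) (W := X)]
  simp
  ring

/-- The gradient of `f`: `g(∇f, v) = df(v)` for all `v`. -/
def grad (f : M → ℝ) (x : M) : TangentSpace I x :=
  sharp g x (mvfderiv I f x).toLinearMap

/-- The Hessian of `f`: `(u, v) ↦ g(∇_u ∇f, v)`. For smooth `f` the gradient is a smooth field. -/
def hess (f : M → ℝ) (x : M) : TangentSpace I x →L[ℝ] TangentSpace I x →L[ℝ] ℝ :=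
  g.inner x ∘L leviCivita g (grad g f) x

/-- The trace with respect to `g` of a field `q` of bilinear forms, as a function on `M`. -/
def metricTrace (q : Π x : M, TangentSpace I x →L[ℝ] TangentSpace I x →L[ℝ] ℝ) (x : M) : ℝ :=
  LinearMap.trace ℝ (TangentSpace I x) (raise g x (q x)).toLinearMap

/-- `(M, g, f)` is a gradient `q`-soliton with constant `lam`: `q` is a smooth `(0,2)`-tensor
field, `f` is a smooth function, and `Hess f = lam g + (1/2) q`. -/
structure IsGradientSoliton
    (q : Π x : M, TangentSpace I x →L[ℝ] TangentSpace I x →L[ℝ] ℝ) (f : M → ℝ) (lam : ℝ) :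
    Prop where
  smooth_tensor : ContMDiff I (I.prod 𝓘(ℝ, E →L[ℝ] E →L[ℝ] ℝ)) ∞
    (fun x ↦ TotalSpace.mk' (E →L[ℝ] E →L[ℝ] ℝ) x (q x))
  smooth_potential : ContMDiff I 𝓘(ℝ, ℝ) ∞ f
  equation : ∀ x : M, hess g f x = lam • g.inner x + (1 / 2 : ℝ) • q x

/-- The Hamilton type identity `Q(∇f) = (1/2) ∇ tr(q)`, where `Q` is the `(1,1)`-tensor dual
to `q`. -/
def HamiltonIdentity
    (q : Π x : M, TangentSpace I x →L[ℝ] TangentSpace I x →L[ℝ] ℝ) (f : M → ℝ) : Prop :=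
  ∀ x : M, raise g x (q x) (grad g f x) = (1 / 2 : ℝ) • grad g (metricTrace g q) x

end RiemannianGeometry

end

/-!
The identity `Q(∇f) = (1/2) ∇ tr(q)` turns the soliton equation into a scalar equation for `f`.
Tracing `Hess f = lam g + (1/2) q` gives `Δf = lam n + (1/2) tr q`
(`IsGradientSoliton.laplacian_eq`). Inserting `∇f` into the equation, and using that the Hessian is
symmetric, gives `(1/2) d|∇f|² = lam df + (1/4) d(tr q)`. So `|∇f|² - 2 lam f - (1/2) tr q` has zero
differential (`IsGradientSoliton.mvfderiv_energy_eq_zero`) and is constant, which for some `C` says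
`Δf = |∇f|² - 2 lam f - C` (`IsGradientSoliton.exists_laplacian_eq`).

At a maximum of `f` the left side is nonpositive and `∇f = 0`, at a minimum it is nonnegative and
`∇f = 0`; hence `-2 lam max f ≤ C ≤ -2 lam min f`. For `lam < 0` this forces `max f ≤ min f`. For
`lam = 0` it forces `C = 0`, so `Δf = |∇f|² ≥ 0`, and a subharmonic function on a compact connected
manifold is constant (`exists_const_of_laplacian_nonneg`). The same result shows that a function
with zero differential is constant.

The strong maximum principle is proved by Hopf's argument. If the set `{f = max f}` is not open,
then, in a chart, some ball outside it has a point of it on its boundary, and one finds a smooth `φ`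
that vanishes at that point with nonzero differential and is negative at the other nearby points of
the set. For `α` large `exp (α φ)` is strictly subharmonic near that point, and adding a small
multiple of it to `f` creates a local maximum at which the Laplacian is positive (`hopf_touching`).

All objects are computed in local frames `s`, `t` that are dual to each other with respect to the
metric (`exists_dual_frames`): the gradient is `∑ df(t i) s i`, and the trace of an endomorphism `A`
is `∑ g(A (s i), t i)`. This gives the smoothness of gradients and traces without coordinates.
-/

open Filter Topology VectorField

namespace RiemannianGeometry

variable {E : Type*} [NormedAddCommGroup E] [NormedSpace ℝ E]
  {H : Type*} [TopologicalSpace H] {I : ModelWithCorners ℝ E H}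
  {M : Type*} [TopologicalSpace M] [ChartedSpace H M]

/-! ### Matrices and functions along curves -/

section Matrix

variable {ι : Type*} [Fintype ι] [DecidableEq ι]

lemma contMDiffAt_det {n : ℕ∞ω} {A : M → Matrix ι ι ℝ} {x : M}
    (hA : ∀ i j, CMDiffAt n (fun y ↦ A y i j) x) : CMDiffAt n (fun y ↦ (A y).det) x := by
  simp only [Matrix.det_apply]
  refine contMDiffAt_finsetSum fun σ _ ↦ ?_
  simp only [Units.smul_def, zsmul_eq_mul]
  exact contMDiffAt_const.mul (contMDiffAt_finsetProd fun i _ ↦ hA _ _)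

lemma contMDiffAt_inv_apply {n : ℕ∞ω} {A : M → Matrix ι ι ℝ} {x : M}
    (hA : ∀ i j, CMDiffAt n (fun y ↦ A y i j) x) (hx : (A x).det ≠ 0) (i j : ι) :
    CMDiffAt n (fun y ↦ (A y)⁻¹ i j) x := by
  have h1 : CMDiffAt n (fun y ↦ ((A y).det)⁻¹) x := (contMDiffAt_det hA).inv₀ hx
  have h2 : CMDiffAt n (fun y ↦ (A y).adjugate i j) x := by
    simp only [Matrix.adjugate_apply]
    refine contMDiffAt_det fun k l ↦ ?_
    by_cases hk : k = j
    · subst hk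
      simpa using contMDiffAt_const
    · simpa [Matrix.updateRow_ne hk] using hA k l
  simpa [Matrix.inv_def, Ring.inverse_eq_inv'] using! h1.mul h2

end Matrix

lemma mvfderiv_eq_fderiv (F : E → ℝ) (y : E) : mvfderiv 𝓘(ℝ, E) F y = fderiv ℝ F y := by
  rw [mvfderiv, mfderiv_eq_fderiv]
  rfl

lemma hasDerivAt_comp_curve {f : M → ℝ} {γ : ℝ → M} {t : ℝ} {w : TangentSpace I (γ t)}
    (hγ : HasMFDerivAt 𝓘(ℝ, ℝ) I γ t ((1 : ℝ →L[ℝ] ℝ).smulRight w)) (hf : MDiffAt f (γ t)) :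
    HasDerivAt (f ∘ γ) (mvfderiv I f (γ t) w) t := by
  refine hasDerivAt_iff_hasFDerivAt.2
    (hasMFDerivAt_iff_hasFDerivAt.1 ((hf.hasMFDerivAt.comp t hγ).congr_mfderiv ?_))
  refine ContinuousLinearMap.ext fun (a : ℝ) ↦ ?_
  change mfderiv I 𝓘(ℝ, ℝ) f (γ t) (a • w) = a • mvfderiv I f (γ t) w
  rw [map_smul]
  rfl

lemma deriv_deriv_nonpos_of_isLocalMax {h : ℝ → ℝ} {a : ℝ} (hmax : IsLocalMax h a)
    (hc : ContinuousAt h a) : deriv (deriv h) a ≤ 0 := by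
  by_contra! hpos
  -- A positive second derivative makes `a` also a local minimum, so `h` is constant near `a`.
  have hmin := isLocalMin_of_deriv_deriv_pos hpos hmax.deriv_eq_zero hc
  have hconst : h =ᶠ[𝓝 a] fun _ ↦ h a := by
    filter_upwards [hmax, hmin] with t h1 h2 using le_antisymm h1 h2
  have := hconst.deriv.deriv_eq
  simp [this] at hpos

/-! ### Differentials and the Lie bracket -/

variable [IsManifold I ∞ M]

lemma eventually_mdifferentiableAt {f : M → ℝ} {x : M} (hf : CMDiffAt 2 f x) :
    ∀ᶠ y in 𝓝 x, MDiffAt f y := by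
  filter_upwards [(contMDiffAt_iff_contMDiffAt_nhds (n := 1) (by simp)).1
    (hf.of_le one_le_two)] with y hy
  exact hy.mdifferentiableAt one_ne_zero

lemma contMDiffAt_mvfderiv_apply {m n : ℕ∞ω} {φ : M → ℝ} {X : Π x : M, TangentSpace I x} {x : M}
    (hφ : ContMDiffAt I 𝓘(ℝ, ℝ) n φ x)
    (hX : ContMDiffAt I (I.prod 𝓘(ℝ, E)) m (fun y ↦ TotalSpace.mk' E y (X y)) x) (hmn : m + 1 ≤ n) :
    ContMDiffAt I 𝓘(ℝ, ℝ) m (fun y ↦ mvfderiv I φ y (X y)) x := by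
  have : IsManifold I 1 M := IsManifold.of_le (n := ∞) (by simp)
  have h := ContMDiffAt.clm_apply_of_inCoordinates (b₁ := id) (b₂ := φ)
    (E₁ := fun x : M ↦ TangentSpace I x) (E₂ := fun y : ℝ ↦ TangentSpace 𝓘(ℝ, ℝ) y)
    (hφ.mfderiv_const hmn) hX (hφ.of_le (le_trans le_self_add hmn))
  rw [contMDiffAt_totalSpace] at h
  simpa [mvfderiv] using! h.2

lemma contMDiffAt_bilin_apply {n : ℕ∞ω} {b : Π x : M, TangentSpace I x →L[ℝ] TangentSpace I x →L[ℝ] ℝ}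
    {Y Z : Π x : M, TangentSpace I x} {x : M}
    (hb : ContMDiffAt I (I.prod 𝓘(ℝ, E →L[ℝ] E →L[ℝ] ℝ)) n
      (fun x ↦ TotalSpace.mk' (E →L[ℝ] E →L[ℝ] ℝ) x (b x)) x)
    (hY : CMDiffAt n (T% Y) x) (hZ : CMDiffAt n (T% Z) x) :
    CMDiffAt n (fun y ↦ b y (Y y) (Z y)) x := by
  have : ContMDiffAt I (I.prod 𝓘(ℝ)) n
      (fun m ↦ TotalSpace.mk' ℝ (E := Bundle.Trivial M ℝ) m (b m (Y m) (Z m))) x :=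
    ContMDiffAt.clm_bundle_apply₂ (F₁ := E) (F₂ := E) hb hY hZ
  simp only [contMDiffAt_totalSpace] at this
  exact this.2

section LieBracket

variable [I.Boundaryless]

/-- The pullback of a field `V` to a chart differentiates functions read in the chart as `V`
differentiates them on the manifold. -/
lemma fderiv_comp_extChartAt_symm_apply {h : M → ℝ} {x : M} {y : E}
    (hy : y ∈ (extChartAt I x).target) (hh : MDiffAt h ((extChartAt I x).symm y))
    (V : Π x : M, TangentSpace I x) :
    fderiv ℝ (h ∘ (extChartAt I x).symm) y
        (mpullback 𝓘(ℝ, E) I (extChartAt I x).symm V y) =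
      mvfderiv I h ((extChartAt I x).symm y) (V ((extChartAt I x).symm y)) := by
  have hd : MDiffAt (extChartAt I x).symm y := by
    have := mdifferentiableWithinAt_extChartAt_symm (I := I) hy
    rwa [I.range_eq_univ, mdifferentiableWithinAt_univ] at this
  have hinv : (mfderiv 𝓘(ℝ, E) I (extChartAt I x).symm y).IsInvertible := by
    have := isInvertible_mfderivWithin_extChartAt_symm (I := I) hy
    rwa [I.range_eq_univ, mfderivWithin_univ] at this
  have key := mvfderiv_comp_apply y hh hd
    (mpullback 𝓘(ℝ, E) I (extChartAt I x).symm V y)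
  rw [mpullback_apply, hinv.self_apply_inverse, mvfderiv_eq_fderiv] at key
  exact key

/-- The Lie bracket acts on functions as the commutator of derivations. Both sides are read in
the chart at `x`, where this is the statement about vector fields on `E`. -/
lemma mvfderiv_mlieBracket [CompleteSpace E] {f : M → ℝ} {V W : Π x : M, TangentSpace I x} {x : M}
    (hf : CMDiffAt 2 f x) (hV : CMDiffAt 1 (T% V) x) (hW : CMDiffAt 1 (T% W) x) :
    mvfderiv I f x (mlieBracket I V W x) =
      mvfderiv I (fun y ↦ mvfderiv I f y (W y)) x (V x) -
        mvfderiv I (fun y ↦ mvfderiv I f y (V y)) x (W x) := by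
  set e := extChartAt I x with he
  set V' : E → E := mpullback 𝓘(ℝ, E) I e.symm V with hV'
  set W' : E → E := mpullback 𝓘(ℝ, E) I e.symm W with hW'
  have hxt : e x ∈ e.target := mem_extChartAt_target x
  have hex : e.symm (e x) = x := extChartAt_to_inv x
  have htn : e.target ∈ 𝓝 (e x) := extChartAt_target_mem_nhds x
  have hsymm : ContinuousAt e.symm (e x) := continuousAt_extChartAt_symm x
  have hF : ContDiffAt ℝ 2 (f ∘ e.symm) (e x) := by
    have := (contMDiffAt_iff.1 hf).2
    rwa [I.range_eq_univ, contDiffWithinAt_univ] at this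
  have hpull {U : Π x : M, TangentSpace I x} (hU : CMDiffAt 1 (T% U) x) :
      DifferentiableAt ℝ (mpullback 𝓘(ℝ, E) I e.symm U : E → E) (e x) := by
    have := contMDiffWithinAt_mpullbackWithin_extChartAt_symm (n := ∞) (m := 1) (s := Set.univ)
      (contMDiffWithinAt_univ.2 hU) uniqueMDiffOn_univ (Set.mem_univ x) 
      (show (1 : ℕ∞ω) + 1 ≤ ∞ by rw [one_add_one_eq_two]; exact WithTop.coe_le_coe.2 le_top)
    have h2 := (contMDiffWithinAt_vectorSpace_iff_contDiffWithinAt.1 this)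
    rw [I.range_eq_univ, mpullbackWithin_univ] at h2
    exact (h2.contDiffAt (by rwa [Set.preimage_univ, Set.inter_univ])).differentiableAt (by simp)
  have hdir {h : M → ℝ} (hh : MDiffAt h x) (U : Π x : M, TangentSpace I x) :
      fderiv ℝ (h ∘ e.symm) (e x) (mpullback 𝓘(ℝ, E) I e.symm U (e x)) =
        mvfderiv I h x (U x) := by
    have := fderiv_comp_extChartAt_symm_apply hxt (h := h) (by rwa [← he, hex]) U
    rw [this, ← he, hex]
  have hev {U : Π x : M, TangentSpace I x} :
      (fun y ↦ fderiv ℝ (f ∘ e.symm) y (mpullback 𝓘(ℝ, E) I e.symm U y)) =ᶠ[𝓝 (e x)]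
        (fun y ↦ mvfderiv I f y (U y)) ∘ e.symm := by
    have h2 : ∀ᶠ z in 𝓝 x, CMDiffAt 2 f z :=
      (contMDiffAt_iff_contMDiffAt_nhds (by simp)).1 hf
    rw [← hex] at h2
    filter_upwards [htn, hsymm.eventually h2] with y hy hy2
    exact fderiv_comp_extChartAt_symm_apply hy (hy2.mdifferentiableAt (by simp)) U
  have hbr : mlieBracket I V W x = (mfderiv I 𝓘(ℝ, E) e x).inverse (lieBracket ℝ V' W' (e x) : E) := by
    rw [← mlieBracketWithin_univ, mlieBracketWithin_apply, I.range_eq_univ, mpullbackWithin_univ,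
      mpullbackWithin_univ, Set.preimage_univ, Set.inter_univ]
    exact congrArg _ (congrFun lieBracketWithin_univ (e x))
  have hinv : (mfderiv I 𝓘(ℝ, E) e x).IsInvertible :=
    isInvertible_mfderiv_extChartAt (mem_extChartAt_source x)
  have hfe (v : TangentSpace I x) :
      fderiv ℝ (f ∘ e.symm) (e x) (mfderiv I 𝓘(ℝ, E) e x v) = mvfderiv I f x v := by
    have h1 : (f ∘ e.symm) ∘ e =ᶠ[𝓝 x] f := by
      filter_upwards [extChartAt_source_mem_nhds (I := I) x] with y hy
      rw [Function.comp_apply, Function.comp_apply, he, (extChartAt I x).left_inv hy]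
    have h2 := mvfderiv_comp_apply (I := 𝓘(ℝ, E)) (I' := I) (g := f ∘ e.symm) (f := e) x
      (hF.differentiableAt (by simp)).mdifferentiableAt
      (mdifferentiableAt_extChartAt (mem_chart_source H x)) v
    have h3 : mvfderiv I ((f ∘ e.symm) ∘ e) x = mvfderiv I f x := by
      simp only [mvfderiv, h1.mfderiv_eq]
      rw [Function.comp_apply, Function.comp_apply, hex]
    rw [← h3, h2, mvfderiv_eq_fderiv]
    rfl
  have hb : mvfderiv I f x (mlieBracket I V W x) =
      fderiv ℝ (f ∘ e.symm) (e x) (lieBracket ℝ V' W' (e x)) := by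
    rw [← hfe, hbr]
    exact congrArg _ (hinv.self_apply_inverse _)
  rw [hb, fderiv_apply_lieBracket hF (by simp) (hpull hW) (hpull hV),
    hev.fderiv_eq, hev.fderiv_eq, hdir, hdir]
  · exact (contMDiffAt_mvfderiv_apply hf hV le_rfl).mdifferentiableAt (by simp)
  · exact (contMDiffAt_mvfderiv_apply hf hW le_rfl).mdifferentiableAt (by simp)

end LieBracket

/-! ### Dual frames, gradients and traces -/

variable (g : ContMDiffRiemannianMetric I ∞ E (fun x : M ↦ TangentSpace I x))

lemma contMDiffAt_metric {n : ℕ∞ω} (hn : n ≤ ∞) {Y Z : Π x : M, TangentSpace I x} {x : M}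
    (hY : CMDiffAt n (T% Y) x) (hZ : CMDiffAt n (T% Z) x) :
    CMDiffAt n (fun y ↦ g.inner y (Y y) (Z y)) x :=
  contMDiffAt_bilin_apply (g.contMDiff.contMDiffAt.of_le hn) hY hZ

variable [FiniteDimensional ℝ E]

/-- Near every point there are smooth frames `s` and `t` that are dual with respect to the metric.
Here `s` is the frame of a trivialization, and `t` is obtained from it by the inverse of the Gram
matrix. -/
lemma exists_dual_frames (x : M) :
    ∃ s t : Fin (Module.finrank ℝ E) → Π y : M, TangentSpace I y,
      (∀ i, CMDiffAt ∞ (T% (s i)) x) ∧ (∀ i, CMDiffAt ∞ (T% (t i)) x) ∧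
      ∀ᶠ y in 𝓝 x, ∀ u : TangentSpace I y, u = ∑ i, g.inner y u (t i y) • s i y := by
  let e := trivializationAt E (TangentSpace I : M → Type _) x
  have hx : x ∈ e.baseSet := FiberBundle.mem_baseSet_trivializationAt' x
  let b := Module.finBasis ℝ E
  -- `∞ + 1 = ∞` holds by definition.
  have : IsManifold I (∞ + 1) M := inferInstanceAs (IsManifold I ∞ M)
  have : ContMDiffVectorBundle ∞ E (TangentSpace I : M → Type _) I :=
    TangentBundle.contMDiffVectorBundle
  let s := e.localFrame b
  have hs (i) : CMDiffAt ∞ (T% (s i)) x := contMDiffAt_localFrame_of_mem ∞ e b i hx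
  -- `W` is the inverse of the Gram matrix of `s`.
  obtain ⟨W, hW, key⟩ : ∃ W : Fin (Module.finrank ℝ E) → Fin (Module.finrank ℝ E) → M → ℝ,
      (∀ i j, CMDiffAt ∞ (W i j) x) ∧ ∀ y ∈ e.baseSet, ∀ k i,
        ∑ j, W j i y * g.inner y (s k y) (s j y) = if k = i then 1 else 0 := by
    let G (y : M) : Matrix (Fin (Module.finrank ℝ E)) (Fin (Module.finrank ℝ E)) ℝ :=
      .of fun i j ↦ g.inner y (s i y) (s j y)
    have hG (i j) : CMDiffAt ∞ (fun y ↦ G y i j) x := contMDiffAt_metric g le_rfl (hs i) (hs j)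
    have hdet {y : M} (hy : y ∈ e.baseSet) : (G y).det ≠ 0 := by
      have hGy : G y = LinearMap.BilinForm.toMatrix (e.basisAt b hy) (form g y) := by
        ext i j
        simp [G, s, hy, form_apply]
      rw [hGy]
      exact (LinearMap.BilinForm.nondegenerate_iff_det_ne_zero (e.basisAt b hy)).1
        (form_nondegenerate g y)
    refine ⟨fun i j y ↦ (G y)⁻¹ i j, contMDiffAt_inv_apply hG (hdet hx), fun y hy k i ↦ ?_⟩
    rw [← Matrix.one_apply, ← Matrix.mul_nonsing_inv (G y) (hdet hy).isUnit, Matrix.mul_apply]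
    exact Finset.sum_congr rfl fun j _ ↦ mul_comm _ _
  refine ⟨s, fun i y ↦ ∑ j, W j i y • s j y, hs, fun i ↦ ?_, ?_⟩
  · exact ContMDiffAt.sum_section fun j _ ↦ (hW j i).smul_section (hs j)
  filter_upwards [e.open_baseSet.mem_nhds hx] with y hy u
  have hu : u = ∑ k, (e.basisAt b hy).repr u k • s k y := by
    conv_lhs => rw [← (e.basisAt b hy).sum_repr u]
    simp [s, hy]
  generalize (e.basisAt b hy).repr u = c at hu
  have hsk (k i) : g.inner y (s k y) (∑ j, W j i y • s j y) = if k = i then 1 else 0 := by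
    rw [map_sum, ← key y hy k i]
    simp
  have hc (i) : g.inner y u (∑ j, W j i y • s j y) = c i := by
    have aux (w : TangentSpace I y) : g.inner y u w = ∑ k, c k * g.inner y (s k y) w := by
      rw [hu]
      simp
    rw [aux]
    simp [hsk, -map_sum]
  simp only [hc]
  exact hu

lemma trace_eq_sum {ι : Type*} [Fintype ι] {x : M} {s t : ι → TangentSpace I x}
    (hst : ∀ u, u = ∑ i, g.inner x u (t i) • s i) (A : TangentSpace I x →L[ℝ] TangentSpace I x) :
    LinearMap.trace ℝ _ A.toLinearMap = ∑ i, g.inner x (A (s i)) (t i) := by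
  have h : A.toLinearMap = ∑ i, ((form g x).flip (t i)).smulRight (A (s i)) := by
    ext u
    have := congrArg A (hst u)
    rw [map_sum] at this
    simpa [form_apply] using this
  rw [h, map_sum]
  simp [LinearMap.trace_smulRight, form_apply]

lemma inner_grad (f : M → ℝ) (x : M) (v : TangentSpace I x) :
    g.inner x (grad g f x) v = mvfderiv I f x v :=
  inner_sharp g x _ v

lemma contMDiffAt_grad {m n : ℕ∞ω} {f : M → ℝ} {x : M} (hf : CMDiffAt n f x)
    (hm : m ≤ ∞) (hmn : m + 1 ≤ n) :
    CMDiffAt m (T% (grad g f)) x := by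
  obtain ⟨s, t, hs, ht, hst⟩ := exists_dual_frames g x
  have h : CMDiffAt m (T% (fun y ↦ ∑ i, mvfderiv I f y (t i y) • s i y)) x :=
    ContMDiffAt.sum_section fun i _ ↦
      (contMDiffAt_mvfderiv_apply hf ((ht i).of_le hm) hmn).smul_section ((hs i).of_le hm)
  refine h.congr_of_eventuallyEq ?_
  filter_upwards [hst] with y hy
  rw [hy (grad g f y)]
  simp [inner_grad]

lemma contMDiffAt_metricTrace {n : ℕ∞ω} (hn : n ≤ ∞)
    {b : Π x : M, TangentSpace I x →L[ℝ] TangentSpace I x →L[ℝ] ℝ} {x : M}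
    (hb : ContMDiffAt I (I.prod 𝓘(ℝ, E →L[ℝ] E →L[ℝ] ℝ)) n
      (fun x ↦ TotalSpace.mk' (E →L[ℝ] E →L[ℝ] ℝ) x (b x)) x) :
    CMDiffAt n (metricTrace g b) x := by
  obtain ⟨s, t, hs, ht, hst⟩ := exists_dual_frames g x
  have h : CMDiffAt n (fun y ↦ ∑ i, b y (s i y) (t i y)) x :=
    contMDiffAt_finsetSum fun i _ ↦
      contMDiffAt_bilin_apply hb ((hs i).of_le hn) ((ht i).of_le hn)
  refine h.congr_of_eventuallyEq ?_
  filter_upwards [hst] with y hy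
  simp [metricTrace, trace_eq_sum g hy, inner_raise]

/-! ### Hessian and Laplacian -/

/-- The Laplacian of `f`: the divergence (trace of the covariant derivative) of the gradient. -/
noncomputable def laplacian (f : M → ℝ) (x : M) : ℝ :=
  LinearMap.trace ℝ (TangentSpace I x) (leviCivita g (grad g f) x).toLinearMap

lemma hess_apply (f : M → ℝ) (x : M) (u v : TangentSpace I x) :
    hess g f x u v = g.inner x (leviCivita g (grad g f) x u) v := rfl

lemma raise_hess (f : M → ℝ) (x : M) :
    raise g x (hess g f x) = leviCivita g (grad g f) x := by
  ext u
  refine metric_ext g x fun w ↦ ?_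
  rw [inner_raise, hess_apply]

lemma metricTrace_hess (f : M → ℝ) (x : M) : metricTrace g (hess g f) x = laplacian g f x := by
  rw [metricTrace, raise_hess, laplacian]

lemma mdifferentiableAt_grad {f : M → ℝ} {x : M} (hf : CMDiffAt 2 f x) :
    MDiffAt (T% (grad g f)) x :=
  (contMDiffAt_grad (m := 1) (n := 2) g hf (by simp) (by rw [one_add_one_eq_two])).mdifferentiableAt
    one_ne_zero

/-- The formula `X (Z f) = Hess f (X, Z) + (∇_X Z) f`. -/
lemma mvfderiv_mvfderiv_apply {f : M → ℝ} {X Z : Π x : M, TangentSpace I x} {x : M}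
    (hf : CMDiffAt 2 f x) (hX : MDiffAt (T% X) x) (hZ : MDiffAt (T% Z) x) :
    mvfderiv I (fun y ↦ mvfderiv I f y (Z y)) x (X x) =
      hess g f x (X x) (Z x) + mvfderiv I f x (leviCivita g Z x (X x)) := by
  have h := leviCivita_metric g hX (mdifferentiableAt_grad g hf) hZ
  simp only [inner_grad] at h
  exact h

/-- The Hessian is symmetric because the Levi-Civita connection has no torsion. -/
lemma hess_symm [I.Boundaryless] {f : M → ℝ} {x : M} (hf : CMDiffAt 2 f x)
    (u v : TangentSpace I x) : hess g f x u v = hess g f x v u := by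
  have : CompleteSpace E := FiniteDimensional.complete ℝ E
  obtain ⟨X, hX, rfl⟩ : ∃ X : Π x : M, TangentSpace I x, CMDiffAt 1 (T% X) x ∧ X x = u :=
    ⟨FiberBundle.extend E u, FiberBundle.contMDiffAt_extend .., by simp⟩
  obtain ⟨Z, hZ, rfl⟩ : ∃ X : Π x : M, TangentSpace I x, CMDiffAt 1 (T% X) x ∧ X x = v :=
    ⟨FiberBundle.extend E v, FiberBundle.contMDiffAt_extend .., by simp⟩
  have hX' := hX.mdifferentiableAt one_ne_zero
  have hZ' := hZ.mdifferentiableAt one_ne_zero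
  have h1 := mvfderiv_mvfderiv_apply g hf hX' hZ'
  have h2 := mvfderiv_mvfderiv_apply g hf hZ' hX'
  have h3 := mvfderiv_mlieBracket hf hX hZ
  have h4 := (CovariantDerivative.torsion_eq_zero_iff _).1 (leviCivita_torsion g) hX' hZ'
  rw [← h4, map_sub] at h3
  linarith

lemma mvfderiv_inner_grad_grad {f : M → ℝ} {x : M} (hf : CMDiffAt 2 f x) (u : TangentSpace I x) :
    mvfderiv I (fun y ↦ g.inner y (grad g f y) (grad g f y)) x u =
      2 * hess g f x u (grad g f x) := by
  obtain ⟨X, hX, rfl⟩ : ∃ X : Π x : M, TangentSpace I x, MDiffAt (T% X) x ∧ X x = u :=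
    ⟨FiberBundle.extend E u, FiberBundle.mdifferentiableAt_extend .., by simp⟩
  rw [leviCivita_metric g hX (mdifferentiableAt_grad g hf) (mdifferentiableAt_grad g hf), hess_apply,
    g.symm x (grad g f x)]
  ring

lemma contMDiffAt_koszul {X Y Z : Π x : M, TangentSpace I x} {x : M}
    (hX : CMDiffAt ∞ (T% X) x) (hY : CMDiffAt ∞ (T% Y) x) (hZ : CMDiffAt ∞ (T% Z) x) :
    CMDiffAt ∞ (koszul g X Y Z) x := by
  have : CompleteSpace E := FiniteDimensional.complete ℝ E
  have : IsManifold I (minSmoothness ℝ 2) M := by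
    rw [minSmoothness_of_isRCLikeNormedField]
    infer_instance
  have : IsManifold I ((⊤ : ℕ∞) + 1) M := inferInstanceAs (IsManifold I ∞ M)
  have hd {U V W : Π x : M, TangentSpace I x} (hU : CMDiffAt ∞ (T% U) x)
      (hV : CMDiffAt ∞ (T% V) x) (hW : CMDiffAt ∞ (T% W) x) :
      CMDiffAt ∞ (fun y ↦ mvfderiv I (fun y ↦ g.inner y (U y) (V y)) y (W y)) x :=
    contMDiffAt_mvfderiv_apply (contMDiffAt_metric g le_rfl hU hV) hW le_rfl
  have hb {U V W : Π x : M, TangentSpace I x} (hU : CMDiffAt ∞ (T% U) x)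
      (hV : CMDiffAt ∞ (T% V) x) (hW : CMDiffAt ∞ (T% W) x) :
      CMDiffAt ∞ (fun y ↦ g.inner y (mlieBracket I U V y) (W y)) x :=
    contMDiffAt_metric g le_rfl
      (ContMDiffAt.mlieBracket_vectorField (m := ⊤) (n := ⊤) hU hV (by simp)) hW
  exact (((((hd hY hZ hX).add (hd hZ hX hY)).sub (hd hX hY hZ)).add (hb hX hY hZ)).sub
    (hb hX hZ hY)).sub (hb hY hZ hX)

/-- In dual frames the Laplacian is a sum of Koszul expressions in smooth fields. -/
lemma continuousAt_laplacian {f : M → ℝ} {x : M} (hf : CMDiffAt ∞ f x) :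
    ContinuousAt (laplacian g f) x := by
  obtain ⟨s, t, hs, ht, hst⟩ := exists_dual_frames g x
  have hgrad : CMDiffAt ∞ (T% (grad g f)) x := contMDiffAt_grad g hf le_rfl le_rfl
  have hd {V : Π x : M, TangentSpace I x} (hV : CMDiffAt ∞ (T% V) x) :
      ∀ᶠ y in 𝓝 x, MDiffAt (T% V) y := by
    filter_upwards [(contMDiffAt_iff_contMDiffAt_nhds (n := 1) (by simp)).1
      (hV.of_le (by simp))] with y hy
    exact hy.mdifferentiableAt one_ne_zero
  have h : ContinuousAt (fun y ↦ ∑ i, 1 / 2 * koszul g (s i) (grad g f) (t i) y) x :=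
    tendsto_finsetSum _ fun i _ ↦
      (contMDiffAt_koszul g (hs i) hgrad (ht i)).continuousAt.const_mul _
  refine h.congr ?_
  filter_upwards [hst, hd hgrad, eventually_all.2 fun i ↦ hd (hs i),
    eventually_all.2 fun i ↦ hd (ht i)] with y hy h1 h2 h3
  rw [laplacian, trace_eq_sum g hy]
  exact Finset.sum_congr rfl fun i _ ↦ (inner_nabla g (h2 i) h1 (h3 i)).symm

section Calculus

variable {g}

lemma leviCivita_congr {Y Z : Π x : M, TangentSpace I x} {x : M} (hY : MDiffAt (T% Y) x)
    (hZ : MDiffAt (T% Z) x) (h : ∀ᶠ y in 𝓝 x, Y y = Z y) :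
    leviCivita g Y x = leviCivita g Z x :=
  (leviCivita g).isCovariantDerivativeOnUniv.congr_of_eventuallyEq hY hZ univ_mem h

lemma grad_add {f h : M → ℝ} {x : M} (hf : MDiffAt f x) (hh : MDiffAt h x) :
    grad g (f + h) x = grad g f x + grad g h x := by
  refine metric_ext g x fun w ↦ ?_
  simp [inner_grad, mvfderiv_add hf hh]

lemma grad_const_mul {f : M → ℝ} {x : M} (c : ℝ) (hf : MDiffAt f x) :
    grad g (fun y ↦ c * f y) x = c • grad g f x := by
  refine metric_ext g x fun w ↦ ?_
  simp [inner_grad, mvfderiv_fun_mul (mdifferentiableAt_const (c := c)) hf, mvfderiv_const]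

lemma grad_exp {f : M → ℝ} {x : M} (hf : MDiffAt f x) :
    grad g (fun y ↦ Real.exp (f y)) x = Real.exp (f x) • grad g f x := by
  refine metric_ext g x fun w ↦ ?_
  have h := mvfderiv_comp_apply (I := 𝓘(ℝ, ℝ)) (I' := I) (g := Real.exp) (f := f) x
    Real.differentiableAt_exp.mdifferentiableAt hf w
  rw [mvfderiv_eq_fderiv] at h
  rw [inner_grad, map_smul, smul_apply, inner_grad]
  refine h.trans ?_
  rw [Real.hasDerivAt_exp (f x) |>.hasFDerivAt.fderiv]
  exact mul_comm _ _

lemma laplacian_add {f h : M → ℝ} {x : M} (hf : CMDiffAt 2 f x) (hh : CMDiffAt 2 h x) :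
    laplacian g (f + h) x = laplacian g f x + laplacian g h x := by
  have hf' := mdifferentiableAt_grad g hf
  have hh' := mdifferentiableAt_grad g hh
  have := leviCivita_congr (g := g) (mdifferentiableAt_grad g (hf.add hh))
    (mdifferentiableAt_add_section hf' hh') (by
      filter_upwards [eventually_mdifferentiableAt hf, eventually_mdifferentiableAt hh] with y h1 h2
      exact grad_add h1 h2)
  rw [laplacian, this]
  have h2 := (leviCivita g).isCovariantDerivativeOnUniv.add hf' hh'
  erw [h2]
  simp [laplacian]

lemma laplacian_const_mul {f : M → ℝ} {x : M} (c : ℝ) (hf : CMDiffAt 2 f x) :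
    laplacian g (fun y ↦ c * f y) x = c * laplacian g f x := by
  have hf' := mdifferentiableAt_grad g hf
  have := leviCivita_congr (g := g) (mdifferentiableAt_grad g (contMDiffAt_const.mul hf))
    (mdifferentiableAt_const (c := c) |>.smul_section hf') (by
      filter_upwards [eventually_mdifferentiableAt hf] with y h1
      exact grad_const_mul c h1)
  have h3 : laplacian g (fun y ↦ c * f y) x = _ := congrArg (fun A : TangentSpace I x →L[ℝ]
    TangentSpace I x ↦ LinearMap.trace ℝ (TangentSpace I x) A.toLinearMap) this
  rw [h3]
  have h2 := (leviCivita g).isCovariantDerivativeOnUniv.smul_const c hf'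
  erw [h2]
  simp [laplacian]

lemma laplacian_exp {f : M → ℝ} {x : M} (hf : CMDiffAt 2 f x) :
    laplacian g (fun y ↦ Real.exp (f y)) x =
      Real.exp (f x) * (laplacian g f x + g.inner x (grad g f x) (grad g f x)) := by
  have hf' := mdifferentiableAt_grad g hf
  have hexp : CMDiffAt 2 (fun y ↦ Real.exp (f y)) x :=
    Real.contDiff_exp.contMDiff.contMDiffAt.comp x hf
  have hexp' := hexp.mdifferentiableAt two_ne_zero
  have := leviCivita_congr (g := g) (mdifferentiableAt_grad g hexp)
    (hexp'.smul_section hf') (by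
      filter_upwards [eventually_mdifferentiableAt hf] with y h1
      exact grad_exp h1)
  rw [laplacian, this]
  have h2 := (leviCivita g).isCovariantDerivativeOnUniv.leibniz hf' hexp'
  have h3 (v) : mvfderiv I (fun y ↦ Real.exp (f y)) x v =
      Real.exp (f x) * g.inner x (grad g f x) v := by
    rw [← inner_grad g, grad_exp (hf.mdifferentiableAt two_ne_zero)]
    simp
  erw [h2]
  have h4 : ((mvfderiv I (fun y ↦ Real.exp (f y)) x).smulRight (grad g f x)).toLinearMap =
    ((mvfderiv I (fun y ↦ Real.exp (f y)) x).toLinearMap).smulRight (grad g f x) := rfl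
  rw [ContinuousLinearMap.toLinearMap_add, map_add, h4, LinearMap.trace_smulRight]
  simp [laplacian, h3]
  ring

end Calculus

/-! ### The maximum principle -/

open Set

variable [I.Boundaryless]

/-- A curve through `x` along which the first two derivatives of `f` at time `0` are `V f` and
`V (V f)`: an integral curve of `V`. -/
lemma exists_curve_through (f : M → ℝ) {x : M} (hf : CMDiffAt 2 f x)
    {V : Π x : M, TangentSpace I x} (hV : CMDiffAt 1 (T% V) x) :
    ∃ γ : ℝ → M, γ 0 = x ∧ ContinuousAt γ 0 ∧ deriv (f ∘ γ) 0 = mvfderiv I f x (V x) ∧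
      deriv (deriv (f ∘ γ)) 0 = mvfderiv I (fun y ↦ mvfderiv I f y (V y)) x (V x) := by
  have : CompleteSpace E := FiniteDimensional.complete ℝ E
  obtain ⟨γ, rfl, hγ⟩ := exists_isMIntegralCurveAt_of_contMDiffAt_boundaryless 0 hV
  have hd : ∀ᶠ t in 𝓝 0, deriv (f ∘ γ) t = mvfderiv I f (γ t) (V (γ t)) := by
    filter_upwards [hγ, hγ.continuousAt.eventually (eventually_mdifferentiableAt hf)] with t h1 h2
    exact (hasDerivAt_comp_curve h1 h2).deriv
  refine ⟨γ, rfl, hγ.continuousAt, hd.self_of_nhds, ?_⟩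
  rw [EventuallyEq.deriv_eq hd]
  exact (hasDerivAt_comp_curve (f := fun y ↦ mvfderiv I f y (V y)) hγ.hasMFDerivAt
    ((contMDiffAt_mvfderiv_apply hf hV (by rw [one_add_one_eq_two])).mdifferentiableAt
      one_ne_zero)).deriv

lemma hess_nonpos_of_isLocalMax {f : M → ℝ} {x : M} (hf : CMDiffAt 2 f x) (hmax : IsLocalMax f x) :
    grad g f x = 0 ∧ ∀ u : TangentSpace I x, hess g f x u u ≤ 0 := by
  have key (u : TangentSpace I x) : mvfderiv I f x u = 0 ∧
      ∃ V : Π x : M, TangentSpace I x, MDiffAt (T% V) x ∧ V x = u ∧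
        mvfderiv I (fun y ↦ mvfderiv I f y (V y)) x u ≤ 0 := by
    obtain ⟨V, hV, rfl⟩ : ∃ X : Π x : M, TangentSpace I x, CMDiffAt 1 (T% X) x ∧ X x = u :=
      ⟨FiberBundle.extend E u, FiberBundle.contMDiffAt_extend .., by simp⟩
    obtain ⟨γ, rfl, hc, h1, h2⟩ := exists_curve_through f hf hV
    have hm : IsLocalMax (f ∘ γ) 0 := hmax.comp_continuous hc
    refine ⟨by rw [← h1, hm.deriv_eq_zero], V, hV.mdifferentiableAt one_ne_zero, rfl, ?_⟩
    rw [← h2]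
    exact deriv_deriv_nonpos_of_isLocalMax hm (hf.continuousAt.comp hc)
  refine ⟨metric_ext g x fun w ↦ by simp [inner_grad, (key w).1], fun u ↦ ?_⟩
  obtain ⟨-, V, hV, rfl, h⟩ := key u
  rwa [mvfderiv_mvfderiv_apply g hf hV hV, (key _).1, add_zero] at h

lemma laplacian_nonpos_of_isLocalMax {f : M → ℝ} {x : M} (hf : CMDiffAt 2 f x)
    (hmax : IsLocalMax f x) : laplacian g f x ≤ 0 := by
  have hsymm : LinearMap.IsSymm (form g x) := ⟨fun u v ↦ g.symm x u v⟩
  let _ : Invertible (2 : ℝ) := invertibleOfNonzero two_ne_zero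
  obtain ⟨v, hv⟩ := LinearMap.BilinForm.exists_orthogonal_basis (K := ℝ) (B := form g x) hsymm
  have hpos (i) : 0 < g.inner x (v i) (v i) := g.pos x (v i) (v.ne_zero i)
  -- The Laplacian is the sum of the `Hess f (v i, v i) / g(v i, v i)` over an orthogonal basis.
  have hst (u : TangentSpace I x) :
      u = ∑ i, g.inner x u ((g.inner x (v i) (v i))⁻¹ • v i) • v i := by
    conv_lhs => rw [← v.sum_repr u]
    refine Finset.sum_congr rfl fun i _ ↦ ?_
    have hu : g.inner x u (v i) = v.repr u i * g.inner x (v i) (v i) := by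
      conv_lhs => rw [← v.sum_repr u]
      rw [map_sum, sum_apply, Finset.sum_eq_single i]
      · simp
      · intro j _ hj
        have : g.inner x (v j) (v i) = 0 := hv hj
        simp [this]
      · simp
    rw [map_smul, hu, smul_eq_mul, mul_comm, mul_assoc, mul_inv_cancel₀ (hpos i).ne', mul_one]
  rw [laplacian, trace_eq_sum g hst]
  refine Finset.sum_nonpos fun i _ ↦ ?_
  rw [map_smul, smul_eq_mul, ← hess_apply]
  exact mul_nonpos_of_nonneg_of_nonpos (inv_nonneg.2 (hpos i).le)
    ((hess_nonpos_of_isLocalMax g hf hmax).2 _)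

variable {g}

/-- Let `f` be subharmonic with maximum `m`, attained at `z`. A smooth `φ` that vanishes at `z` and
is negative at all other nearby points where `f = m` has zero differential at `z`. -/
lemma hopf_touching [T2Space M] [CompactSpace M] {f φ : M → ℝ} {m : ℝ} {z : M}
    (hf : CMDiff 2 f) (hsub : ∀ x, 0 ≤ laplacian g f x) (hle : ∀ x, f x ≤ m)
    (hz : f z = m) (hφ : CMDiffAt ∞ φ z) (hφz : φ z = 0)
    (htouch : ∀ᶠ x in 𝓝 z, f x = m → x ≠ z → φ x < 0) : mvfderiv I φ z = 0 := by
  by_contra hdφ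
  have hc : 0 < g.inner z (grad g φ z) (grad g φ z) := by
    refine g.pos z _ fun h0 ↦ hdφ ?_
    ext w
    rw [← inner_grad g, h0]
    simp
  -- For such `α`, the function `exp (α φ)` is strictly subharmonic at `z`.
  obtain ⟨α, hα, hαz⟩ : ∃ α : ℝ, 0 < α ∧
      0 < laplacian g φ z + α * g.inner z (grad g φ z) (grad g φ z) := by
    refine ⟨(|laplacian g φ z| + 1) / g.inner z (grad g φ z) (grad g φ z), by positivity, ?_⟩
    rw [div_mul_cancel₀ _ hc.ne']
    linarith [neg_abs_le (laplacian g φ z)]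
  let v : M → ℝ := fun y ↦ Real.exp (α * φ y)
  have hgrad : CMDiffAt ∞ (T% (grad g φ)) z := contMDiffAt_grad g hφ le_rfl le_rfl
  have hcont : ContinuousAt
      (fun y ↦ laplacian g φ y + α * g.inner y (grad g φ y) (grad g φ y)) z :=
    (continuousAt_laplacian g hφ).add
      (continuousAt_const.mul (contMDiffAt_metric g le_rfl hgrad hgrad).continuousAt)
  have hφ2 : ∀ᶠ y in 𝓝 z, CMDiffAt 2 φ y :=
    (contMDiffAt_iff_contMDiffAt_nhds (by simp)).1 (hφ.of_le (WithTop.coe_le_coe.2 le_top))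
  have hvd {y : M} (hy : CMDiffAt 2 φ y) : CMDiffAt 2 v y :=
    Real.contDiff_exp.contMDiff.contMDiffAt.comp y (contMDiffAt_const.mul hy)
  have hgood : ∀ᶠ y in 𝓝 z, CMDiffAt 2 φ y ∧ 0 < laplacian g v y ∧
      (f y = m → y ≠ z → φ y < 0) := by
    filter_upwards [hφ2, hcont.eventually (lt_mem_nhds hαz), htouch] with y h1 h2 h3
    refine ⟨h1, ?_, h3⟩
    have h4 := laplacian_exp (g := g) (f := fun y ↦ α * φ y) (x := y) (contMDiffAt_const.mul h1)
    rw [laplacian_const_mul α h1, grad_const_mul α (h1.mdifferentiableAt two_ne_zero)] at h4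
    have h5 : laplacian g v y = Real.exp (α * φ y) * (α *
        (laplacian g φ y + α * g.inner y (grad g φ y) (grad g φ y))) := by
      refine h4.trans ?_
      simp only [map_smul, smul_apply, smul_eq_mul]
      ring
    rw [h5]
    positivity
  obtain ⟨N, hN, hNclosed, hNgood⟩ := exists_mem_nhds_isClosed_subset hgood
  have hNcomp : IsCompact N := hNclosed.isCompact
  have hvc : ContinuousOn v N := fun y hy ↦ (hvd (hNgood hy).1).continuousAt.continuousWithinAt
  have hzint : z ∈ interior N := mem_interior_iff_mem_nhds.2 hN
  have hfrN : frontier N ⊆ N := hNclosed.frontier_subset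
  have hfr : IsCompact (frontier N) := isClosed_frontier.isCompact
  have hvz : v z = 1 := by simp [v, hφz]
  -- On the frontier of `N`, points with `v ≥ 1` form a compact set on which `f < m`, so that a small
  -- multiple of `v` does not spoil the inequality; where `v < 1` every `ε > 0` will do.
  obtain ⟨ε, hε, hεfr⟩ : ∃ ε : ℝ, 0 < ε ∧ ∀ x ∈ frontier N, f x + ε * v x < m + ε := by
    let A := frontier N ∩ v ⁻¹' Ici 1
    have hA : IsCompact A := hfr.of_isClosed_subset
      ((hvc.mono hfrN).preimage_isClosed_of_isClosed isClosed_frontier isClosed_Ici)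
      inter_subset_left
    have hAf : ∀ x ∈ A, f x < m := by
      refine fun x hx ↦ lt_of_le_of_ne (hle x) fun hxm ↦ ?_
      have hxz : x ≠ z := by
        rintro rfl
        exact hx.1.2 hzint
      have hneg := (hNgood (hfrN hx.1)).2.2 hxm hxz
      have : v x < 1 := Real.exp_lt_one_iff.2 (mul_neg_of_pos_of_neg hα hneg)
      exact absurd hx.2 (not_le.2 this)
    rcases A.eq_empty_or_nonempty with hempty | hne
    · refine ⟨1, one_pos, fun x hx ↦ ?_⟩
      have : v x < 1 := by
        by_contra! h1
        exact (hempty ▸ (⟨hx, h1⟩ : x ∈ A) : x ∈ (∅ : Set M))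
      linarith [hle x]
    · obtain ⟨a, ha, hamax⟩ := hA.exists_isMaxOn hne hf.continuous.continuousOn
      obtain ⟨B, hB⟩ := hA.bddAbove_image ((hvc.mono hfrN).mono inter_subset_left)
      have hδ : 0 < m - f a := sub_pos.2 (hAf a ha)
      have hB1 : (0 : ℝ) < |B| + 1 := by positivity
      refine ⟨(m - f a) / (|B| + 1), by positivity, fun x hx ↦ ?_⟩
      set ε := (m - f a) / (|B| + 1) with hεdef
      have hε : 0 < ε := by positivity
      by_cases hxA : x ∈ A
      · have h1 : f x ≤ f a := hamax hxA
        have h2 : v x ≤ |B| := (hB (mem_image_of_mem v hxA)).trans (le_abs_self B)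
        have h3 : ε * (|B| + 1) = m - f a := div_mul_cancel₀ _ hB1.ne'
        nlinarith
      · have h1 : v x < 1 := by
          by_contra! h1
          exact hxA ⟨hx, h1⟩
        nlinarith [hle x]
  -- `f + ε v` has value `m + ε` at `z`, so its maximum over `N` is not on the frontier.
  obtain ⟨a, haN, hamax⟩ := hNcomp.exists_isMaxOn ⟨z, interior_subset hzint⟩
    (f := fun x ↦ f x + ε * v x)
    (hf.continuous.continuousOn.add (continuousOn_const.mul hvc))
  have haint : a ∈ interior N := by
    by_contra hna
    have h1 := hεfr a (by rw [hNclosed.frontier_eq]; exact ⟨haN, hna⟩)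
    have h2 : f z + ε * v z ≤ f a + ε * v a := hamax (interior_subset hzint)
    rw [hz, hvz] at h2
    linarith
  have hloc : IsLocalMax (fun x ↦ f x + ε * v x) a :=
    hamax.isLocalMax (mem_interior_iff_mem_nhds.1 haint)
  have hva := hvd (hNgood haN).1
  have h1 : laplacian g (fun x ↦ f x + ε * v x) a = laplacian g f a + ε * laplacian g v a := by
    rw [← laplacian_const_mul ε hva]
    exact laplacian_add hf.contMDiffAt (contMDiffAt_const.mul hva)
  have h2 := laplacian_nonpos_of_isLocalMax g
    (hf.contMDiffAt.add (contMDiffAt_const.mul hva)) hloc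
  have h3 := (hNgood haN).2.1
  have h4 := hsub a
  have h5 : laplacian g (fun x ↦ f x + ε * v x) a ≤ 0 := h2
  nlinarith [mul_pos hε h3]

/-- Strong maximum principle: a subharmonic function on a compact connected manifold is constant. -/
theorem exists_const_of_laplacian_nonneg [T2Space M] [CompactSpace M] [ConnectedSpace M]
    {f : M → ℝ} (hf : CMDiff 2 f) (hsub : ∀ x, 0 ≤ laplacian g f x) : ∃ c, ∀ x, f x = c := by
  obtain ⟨x₀, -, hx₀⟩ := isCompact_univ.exists_isMaxOn univ_nonempty hf.continuous.continuousOn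
  have hle (x) : f x ≤ f x₀ := hx₀ (mem_univ x)
  generalize hm : f x₀ = m at hle
  let K : Set M := {x | f x = m}
  have hK : IsClosed K := isClosed_eq hf.continuous continuous_const
  suffices hopen : IsOpen K by
    have huniv : K = univ := IsClopen.eq_univ ⟨hK, hopen⟩ ⟨x₀, hm⟩
    exact ⟨m, fun x ↦ (huniv ▸ mem_univ x : x ∈ K)⟩
  refine isOpen_iff_mem_nhds.2 fun p hp ↦ ?_
  by_contra hKp
  set e := extChartAt I p with he
  -- A Euclidean norm on the model space makes squared distances smooth.
  let L : E ≃L[ℝ] _ := toEuclidean (E := E)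
  let Θ := fun w ↦ e.symm (L.symm w)
  have hT : L.symm ⁻¹' e.target ∈ 𝓝 (L (e p)) := by
    refine L.symm.continuous.continuousAt.preimage_mem_nhds ?_
    rw [L.symm_apply_apply]
    exact extChartAt_target_mem_nhds p
  obtain ⟨R, hR, hRT⟩ := Metric.nhds_basis_closedBall.mem_iff.1 hT
  have hΘ : ContinuousOn Θ (Metric.closedBall (L (e p)) R) :=
    (continuousOn_extChartAt_symm p).comp L.symm.continuous.continuousOn hRT
  -- `y` is the centre of a ball outside the maximum set, closer to `p` than to the edge of the chart
  -- ball, so that the point `w` of the maximum set nearest to `y` is interior to the chart ball.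
  obtain ⟨y, hy, hyK⟩ : ∃ y ∈ Metric.ball (L (e p)) (R / 2), Θ y ∉ K := by
    by_contra! hall
    apply hKp
    have hcont : ContinuousAt (fun x ↦ L (e x)) p :=
      L.continuous.continuousAt.comp (continuousAt_extChartAt p)
    filter_upwards [hcont.preimage_mem_nhds (Metric.ball_mem_nhds _ (half_pos hR)),
      extChartAt_source_mem_nhds (I := I) p] with x h1 h2
    have h3 := hall _ h1
    simpa [Θ, he, -extChartAt, (extChartAt I p).left_inv h2] using h3
  have hcomp : IsCompact (Metric.closedBall (L (e p)) R ∩ Θ ⁻¹' K) :=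
    (isCompact_closedBall _ _).of_isClosed_subset
      (hΘ.preimage_isClosed_of_isClosed Metric.isClosed_closedBall hK) inter_subset_left
  have hpK : L (e p) ∈ Metric.closedBall (L (e p)) R ∩ Θ ⁻¹' K := by
    refine ⟨Metric.mem_closedBall_self hR.le, ?_⟩
    have : Θ (L (e p)) = p := by
      simp only [Θ, L.symm_apply_apply]
      exact extChartAt_to_inv p
    rwa [mem_preimage, this]
  obtain ⟨w, ⟨hwR, hwK⟩, hwmin⟩ := hcomp.exists_isMinOn ⟨_, hpK⟩
    (f := fun w ↦ ‖w - y‖) (by fun_prop)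
  have hwy : w ≠ y := by
    rintro rfl
    exact hyK hwK
  have hwball : w ∈ Metric.ball (L (e p)) R := by
    have h1 : ‖w - y‖ ≤ ‖L (e p) - y‖ := hwmin hpK
    rw [Metric.mem_ball, dist_eq_norm] at hy ⊢
    have h2 := norm_add_le (w - y) (y - L (e p))
    rw [sub_add_sub_cancel] at h2
    rw [norm_sub_rev] at h1
    rw [norm_sub_rev (L (e p)) y, norm_sub_rev y w] at h1
    linarith
  have hwt : L.symm w ∈ e.target := hRT hwR
  have hΘw : e (Θ w) = L.symm w := e.right_inv hwt
  have hsrc : Θ w ∈ e.source := e.map_target hwt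
  -- The term `‖L u - y‖ ^ 2` makes `G ≤ 0` on the maximum set, the term `‖L u - w‖ ^ 2` makes `w`
  -- the only zero of `G` there; the latter has zero derivative at `w`.
  let G : E → ℝ := fun u ↦ ‖w - y‖ ^ 2 - ‖L u - y‖ ^ 2 - ‖L u - w‖ ^ 2
  have hG : ContDiff ℝ ∞ G := by
    have h1 (c) : ContDiff ℝ ∞ fun u ↦ ‖L u - c‖ ^ 2 :=
      (L.contDiff.sub contDiff_const).norm_sq ℝ
    exact (contDiff_const.sub (h1 y)).sub (h1 w)
  have hφ : CMDiffAt ∞ (G ∘ e) (Θ w) :=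
    hG.contMDiff.contMDiffAt.comp _ (contMDiffAt_extChartAt' (by rwa [← extChartAt_source I p]))
  have hzero := hopf_touching hf hsub hle hwK hφ
    (by simp [G, hΘw]) (by
      have hcont : ContinuousAt (fun x ↦ L (e x)) (Θ w) :=
        L.continuous.continuousAt.comp (continuousAt_extChartAt' hsrc)
      have hb : Metric.ball (L (e p)) R ∈ 𝓝 (L (e (Θ w))) := by
        rw [hΘw, L.apply_symm_apply]
        exact Metric.isOpen_ball.mem_nhds hwball
      filter_upwards [hcont.preimage_mem_nhds hb, extChartAt_source_mem_nhds' hsrc]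
        with x h1 h2 h3 h4
      have hx : Θ (L (e x)) = x := by
        simp only [Θ, L.symm_apply_apply]
        exact e.left_inv h2
      have h5 : ‖w - y‖ ≤ ‖L (e x) - y‖ :=
        hwmin ⟨Metric.ball_subset_closedBall h1, by rw [mem_preimage, hx]; exact h3⟩
      have h6 : 0 < ‖L (e x) - w‖ := by
        refine norm_pos_iff.2 (sub_ne_zero.2 fun h ↦ h4 ?_)
        rw [← hx, h]
      have h7 : ‖w - y‖ ^ 2 ≤ ‖L (e x) - y‖ ^ 2 := by gcongr
      simp only [Function.comp_apply, G]
      nlinarith [pow_pos h6 2])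
  have hG' : fderiv ℝ G (L.symm w) = 0 := by
    have hd : MDifferentiableAt 𝓘(ℝ, E) I e.symm (L.symm w) := by
      have := mdifferentiableWithinAt_extChartAt_symm (I := I) hwt
      rwa [I.range_eq_univ, mdifferentiableWithinAt_univ] at this
    have h1 : (G ∘ e) ∘ e.symm =ᶠ[𝓝 (L.symm w)] G := by
      filter_upwards [(isOpen_extChartAt_target p).mem_nhds hwt] with u hu
      simp only [Function.comp_apply]
      rw [e.right_inv hu]
    refine ContinuousLinearMap.ext fun u ↦ ?_
    have h2 := mvfderiv_comp_apply (L.symm w) (hφ.mdifferentiableAt (by simp)) hd u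
    rw [mvfderiv_eq_fderiv, h1.fderiv_eq] at h2
    refine h2.trans ?_
    change mvfderiv I (G ∘ e) (Θ w) _ = 0
    rw [hzero]
    rfl
  -- The derivative of `G` in the direction `w - y` is `-2 ‖w - y‖ ^ 2`.
  have hG2 : HasFDerivAt G _ (L.symm w) :=
    ((hasFDerivAt_const (‖w - y‖ ^ 2) (L.symm w)).sub
      ((L.hasFDerivAt.sub_const y).norm_sq)).sub ((L.hasFDerivAt.sub_const w).norm_sq)
  have h3 := congrArg (fun A : E →L[ℝ] ℝ ↦ A (L.symm (w - y))) (hG2.fderiv.symm.trans hG')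
  have h4 : w - y = 0 := by simpa [-map_sub] using h3
  exact hwy (sub_eq_zero.1 h4)

/-! ### Gradient solitons -/

variable {q : Π x : M, TangentSpace I x →L[ℝ] TangentSpace I x →L[ℝ] ℝ} {f : M → ℝ} {lam : ℝ}

omit [I.Boundaryless] in
lemma laplacian_eq_zero_of_mvfderiv_eq_zero {F : M → ℝ} (hF : ∀ x, mvfderiv I F x = 0) (x : M) :
    laplacian g F x = 0 := by
  have hgrad : grad g F = 0 := by
    funext y
    refine metric_ext g y fun w ↦ ?_
    rw [inner_grad, hF]
    simp
  rw [laplacian, hgrad, (leviCivita g).zero]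
  simp

namespace IsGradientSoliton

omit [I.Boundaryless] in
/-- The trace of the soliton equation. -/
lemma laplacian_eq (h : IsGradientSoliton g q f lam) (x : M) :
    laplacian g f x = lam * Module.finrank ℝ E + 1 / 2 * metricTrace g q x := by
  have hraise : raise g x (hess g f x) =
      lam • ContinuousLinearMap.id ℝ _ + (1 / 2 : ℝ) • raise g x (q x) := by
    ext u
    refine metric_ext g x fun w ↦ ?_
    rw [inner_raise, h.equation]
    simp [inner_raise]
  rw [← metricTrace_hess, metricTrace, hraise]
  have : LinearMap.trace ℝ (TangentSpace I x) LinearMap.id = Module.finrank ℝ E :=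
    LinearMap.trace_id ℝ (TangentSpace I x)
  simp [metricTrace, this]

lemma mvfderiv_energy_eq_zero (h : IsGradientSoliton g q f lam) (hH : HamiltonIdentity g q f)
    (x : M) : mvfderiv I (fun y ↦ g.inner y (grad g f y) (grad g f y) - 2 * lam * f y
      - 1 / 2 * metricTrace g q y) x = 0 := by
  have hf := h.smooth_potential x
  have hf2 : CMDiffAt 2 f x := hf.of_le (WithTop.coe_le_coe.2 le_top)
  have hfd : MDiffAt f x := hf2.mdifferentiableAt two_ne_zero
  have hgrad := mdifferentiableAt_grad g hf2
  have hq : MDiffAt (metricTrace g q) x :=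
    (contMDiffAt_metricTrace g le_rfl (h.smooth_tensor x)).mdifferentiableAt (by simp)
  have hn := mdifferentiableAt_metric g hgrad hgrad
  have hc (c : ℝ) : MDifferentiableAt I 𝓘(ℝ, ℝ) (fun _ : M ↦ c) x := mdifferentiableAt_const
  have hlf : MDiffAt (fun y ↦ 2 * lam * f y) x := (hc (2 * lam)).mul hfd
  have hq' : MDiffAt (fun y ↦ 1 / 2 * metricTrace g q y) x := (hc (1 / 2)).mul hq
  have hnlf : MDiffAt (fun y ↦ g.inner y (grad g f y) (grad g f y) - 2 * lam * f y) x := hn.sub hlf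
  rw [mvfderiv_fun_sub hnlf hq', mvfderiv_fun_sub hn hlf, mvfderiv_fun_mul (hc (2 * lam)) hfd,
    mvfderiv_fun_mul (hc (1 / 2)) hq, mvfderiv_const, mvfderiv_const]
  ext u
  have hu : q x (grad g f x) u = 1 / 2 * mvfderiv I (metricTrace g q) x u := by
    rw [← inner_raise g x (q x), hH x]
    simp [inner_grad]
  have hs : hess g f x u (grad g f x) = lam * mvfderiv I f x u + 1 / 2 * q x (grad g f x) u := by
    rw [hess_symm g hf2, h.equation]
    simp [inner_grad]
  simp only [sub_apply, smul_apply, smul_eq_mul, mvfderiv_inner_grad_grad g hf2 u, hs,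
    hu, smul_zero, add_zero, zero_apply]
  ring

lemma exists_laplacian_eq [T2Space M] [CompactSpace M] [ConnectedSpace M]
    (h : IsGradientSoliton g q f lam) (hH : HamiltonIdentity g q f) :
    ∃ C : ℝ, ∀ x, laplacian g f x =
      g.inner x (grad g f x) (grad g f x) - 2 * lam * f x - C := by
  have hgrad (x : M) : CMDiffAt ∞ (T% (grad g f)) x :=
    contMDiffAt_grad g (h.smooth_potential x) le_rfl le_rfl
  have hF : CMDiff ∞ (fun y ↦ g.inner y (grad g f y) (grad g f y) - 2 * lam * f y
      - 1 / 2 * metricTrace g q y) := fun x ↦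
    ((contMDiffAt_metric g le_rfl (hgrad x) (hgrad x)).sub
      (contMDiffAt_const.mul (h.smooth_potential x))).sub
      (contMDiffAt_const.mul (contMDiffAt_metricTrace g le_rfl (h.smooth_tensor x)))
  -- A function with zero differential is subharmonic, hence constant.
  obtain ⟨C, hC⟩ := exists_const_of_laplacian_nonneg (g := g)
    (hF.of_le (WithTop.coe_le_coe.2 le_top)) fun x ↦
      (laplacian_eq_zero_of_mvfderiv_eq_zero (h.mvfderiv_energy_eq_zero hH) x).ge
  refine ⟨C - lam * Module.finrank ℝ E, fun x ↦ ?_⟩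
  rw [h.laplacian_eq, ← hC x]
  ring

end IsGradientSoliton

end RiemannianGeometry

open RiemannianGeometry in
/-- A compact gradient `q`-soliton with `lam ≤ 0` that satisfies the Hamilton type identity
`Q(∇f) = (1/2) ∇ tr(q)` has constant potential function. -/
theorem theorem1p1 {E : Type*} [NormedAddCommGroup E] [NormedSpace ℝ E] [FiniteDimensional ℝ E]
    {M : Type*} [TopologicalSpace M] [ChartedSpace E M] [IsManifold 𝓘(ℝ, E) ∞ M]
    [T2Space M] [CompactSpace M] [ConnectedSpace M]
    (g : ContMDiffRiemannianMetric 𝓘(ℝ, E) ∞ E (fun x : M ↦ TangentSpace 𝓘(ℝ, E) x))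
    (q : Π x : M, TangentSpace 𝓘(ℝ, E) x →L[ℝ] TangentSpace 𝓘(ℝ, E) x →L[ℝ] ℝ)
    (f : M → ℝ) (lam : ℝ) (hlam : lam ≤ 0)
    (hsol : RiemannianGeometry.IsGradientSoliton g q f lam)
    (hHam : RiemannianGeometry.HamiltonIdentity g q f) :
    ∃ c : ℝ, ∀ x : M, f x = c := by
  have hf2 : CMDiff 2 f := hsol.smooth_potential.of_le (WithTop.coe_le_coe.2 le_top)
  obtain ⟨C, hC⟩ := hsol.exists_laplacian_eq hHam
  obtain ⟨a, -, ha⟩ := isCompact_univ.exists_isMaxOn Set.univ_nonempty hf2.continuous.continuousOn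
  obtain ⟨b, -, hb⟩ := isCompact_univ.exists_isMinOn Set.univ_nonempty hf2.continuous.continuousOn
  have hamax : IsLocalMax f a := ha.isLocalMax Filter.univ_mem
  -- A minimum of `f` is treated as a maximum of `-f`.
  have hbmax : IsLocalMax (fun y ↦ -1 * f y) b := by
    filter_upwards with x
    have : f b ≤ f x := hb (Set.mem_univ x)
    linarith
  have h1 := laplacian_nonpos_of_isLocalMax g (hf2 a) hamax
  have h2 := laplacian_nonpos_of_isLocalMax g (contMDiffAt_const.mul (hf2 b)) hbmax
  have h3 : -1 * laplacian g f b ≤ 0 := by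
    rw [← laplacian_const_mul (-1) (hf2 b)]
    exact h2
  have hgb : grad g f b = 0 := by
    have h4 := (hess_nonpos_of_isLocalMax g (f := fun y ↦ -1 * f y) (contMDiffAt_const.mul (hf2 b)) hbmax).1
    have h5 : (-1 : ℝ) • grad g f b = 0 := by
      rw [← h4]
      exact (grad_const_mul (-1) ((hf2 b).mdifferentiableAt two_ne_zero)).symm
    simpa using h5
  rw [hC, (hess_nonpos_of_isLocalMax g (hf2 a) hamax).1, map_zero] at h1
  rw [hC, hgb, map_zero] at h3
  rcases hlam.lt_or_eq with hneg | rfl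
  · refine ⟨f a, fun x ↦ le_antisymm (ha (Set.mem_univ x)) ?_⟩
    have h6 : f b ≤ f x := hb (Set.mem_univ x)
    nlinarith
  · refine exists_const_of_laplacian_nonneg (g := g) hf2 fun x ↦ ?_
    have hC0 : C = 0 := by linarith
    rw [hC, hC0]
    by_cases h0 : grad g f x = 0
    · simp [h0]
    · simpa using (g.pos x _ h0).le
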